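/- Let $p$ be an odd prime and let $D_{2p}=\langle \tau,\sigma \mid \tau^p=\sigma^2=e,\ \sigma\tau\sigma=\tau^{-1}\rangle$ be the dihedral group of order $2p$. For a subset $S\subseteq D_{2p}\setminus\{e\}$ with $S^{-1}=S$, the Cayley graph $\mathrm{Cay}(D_{2p},S)$ is the undirected graph with vertex set $D_{2p}$ in which $g$ and $h$ are adjacent if and only if $hg^{-1}\in S$. Then the number of Cayley graphs on $D_{2p}$ (connected or not), up to graph isomorphism, is equal to $$\mathcal{N}'=\frac{1}{p}\Bigl(2^{\frac{p+1}{2}}-2^{\frac{3p-1}{2}}\Bigr)+\frac{2}{p-1}\sum_{i=0}^{p-2}2^{\frac{\gcd(2i,\,p-1)}{2}+\gcd(i,\,p-1)},$$ where $\gcd(0,p-1)=p-1$. -/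

import Mathlib

/-- The inverse-closed subsets of a group `G` that do not contain the identity. -/
def ConnectionSet (G : Type*) [Group G] : Type _ :=
  {S : Set G // (1 : G) ∉ S ∧ S⁻¹ = S}

/-- The (undirected) Cayley graph `Cay(G, S)`: its vertex set is `G`, and `g` is joined to `h`
exactly when `h * g⁻¹ ∈ S`. -/
def cayleyGraph {G : Type*} [Group G] (S : ConnectionSet G) : SimpleGraph G where
  Adj g h := h * g⁻¹ ∈ S.1
  symm := ⟨fun g h hgh => by
    have h1 : (h * g⁻¹)⁻¹ ∈ S.1 := by
      rw [← Set.mem_inv, S.2.2]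
      exact hgh
    simpa using h1⟩
  loopless := ⟨fun g hg => S.2.1 (by simpa using hg)⟩

/-- Isomorphism of Cayley graphs, as an equivalence relation. The isomorphisms are arbitrary
graph isomorphisms (adjacency-preserving bijections of the vertex sets). -/
def cayleyGraphIso (G : Type*) [Group G] :
    Setoid {X : SimpleGraph G // ∃ S : ConnectionSet G, X = cayleyGraph S} where
  r X Y := Nonempty (X.1 ≃g Y.1)
  iseqv :=
    { refl := fun _ => ⟨SimpleGraph.Iso.refl⟩
      symm := fun ⟨f⟩ => ⟨f.symm⟩
      trans := fun ⟨f⟩ ⟨g⟩ => ⟨g.comp f⟩ }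

/-- The number of Cayley graphs on `G` up to isomorphism. -/
noncomputable def numCayleyGraphs (G : Type*) [Group G] : ℕ :=
  Nat.card (Quotient (cayleyGraphIso G))

/-! ### Abelian Sylow p-subgroups. -/

open DihedralGroup Pointwise

/-! Babai's argument reduces the count to orbits. Automorphisms of a Cayley graph permute 2p points
and p³ does not divide (2p)!, so the Sylow p-subgroups of its automorphism group are abelian. Hence,
given an isomorphism of Cayley graphs, the translation by `r 1` and its pullback commute after
conjugation by an automorphism (`exists_iso_commute`). The corrected isomorphism is affine on each
rotation coset (`exists_affine_of_commute`), which yields a group automorphism matching the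
connection sets.

Isomorphism classes are therefore orbits of Aut(D_{2p}), a group of order p(p-1) formed by the
`affineAut a d`, and Burnside applies. A fixed S consists of nonzero rotations invariant under a and
-1, and reflections invariant under x ↦ ax + d. For a = g^i ≠ 1, with g a generator of the units,
these contribute 2^(gcd(2i,p-1)/2) and 2^(gcd(i,p-1)+1) choices. The case a = 1 deviates, because
nonzero translations have no fixed point; this produces the 1/p term. -/

/-- In a finite group whose order is not divisible by `p ^ 3`, two elements with trivial `p`-th
power commute up to conjugation. -/
theorem exists_commute_conj_of_not_dvd {A : Type*} [Group A] [Finite A] {p : ℕ} [Fact p.Prime]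
    (hA : ¬ p ^ 3 ∣ Nat.card A) {x y : A} (hx : x ^ p = 1) (hy : y ^ p = 1) :
    ∃ g : A, Commute x (g * y * g⁻¹) := by
  have key : ∀ z : A, z ^ p = 1 → ∃ P : Sylow p A, z ∈ P := by
    intro z hz
    have hP : IsPGroup p (Subgroup.zpowers z) := by
      rintro ⟨w, k, rfl⟩
      refine ⟨1, Subtype.ext ?_⟩
      simp only [pow_one, Subgroup.coe_pow, Subgroup.coe_one]
      rw [← zpow_natCast, zpow_comm, zpow_natCast, hz, one_zpow]
    obtain ⟨Q, hQ⟩ := hP.exists_le_sylow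
    exact ⟨Q, hQ (Subgroup.mem_zpowers z)⟩
  obtain ⟨P, hxP⟩ := key x hx
  obtain ⟨Q, hyQ⟩ := key y hy
  obtain ⟨g, hg⟩ := MulAction.exists_smul_eq A Q P
  refine ⟨g, ?_⟩
  have hyP : g * y * g⁻¹ ∈ P := by
    rw [← hg]
    exact Subgroup.smul_mem_pointwise_smul y (MulAut.conj g) Q hyQ
  obtain ⟨k, hk⟩ := IsPGroup.iff_card.mp P.isPGroup'
  have hk2 : k ≤ 2 := by
    by_contra hlt
    exact hA ((pow_dvd_pow p (by omega)).trans (hk ▸ P.1.card_subgroup_dvd_card))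
  have hcomm : ∀ a b : P, a * b = b * a := by
    interval_cases k
    · have : Subsingleton P := (Nat.card_eq_one_iff_unique.mp (by simpa using hk)).1
      exact fun a b => Subsingleton.elim _ _
    · have : IsCyclic P := isCyclic_of_prime_card (p := p) (by simpa using hk)
      exact this.isMulCommutative.is_comm.comm
    · exact (IsPGroup.isMulCommutative_of_card_eq_prime_sq hk).is_comm.comm
  exact congrArg Subtype.val (hcomm ⟨x, hxP⟩ ⟨_, hyP⟩)

/-- Among 1, …, 2p only p and 2p are multiples of p, and neither is a multiple of p² since p is odd,
so the valuation is 2. -/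
theorem not_cube_dvd_factorial_two_mul {p : ℕ} (hp : p.Prime) (hodd : Odd p) :
    ¬ p ^ 3 ∣ (2 * p).factorial := by
  have : Fact p.Prime := ⟨hp⟩
  have h2 : p ≠ 2 := by rintro rfl; exact absurd hodd (by decide)
  have h3 : 2 < p := lt_of_le_of_ne hp.two_le (Ne.symm h2)
  rw [padicValNat_dvd_iff_le (Nat.factorial_ne_zero _), mul_comm, padicValNat_factorial_mul,
    padicValNat.eq_zero_of_not_dvd (fun h => absurd ((hp.dvd_factorial).mp h) (by omega))]
  omega

/-! ### Affine maps of the dihedral group. -/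

namespace DihedralGroup

variable {p : ℕ}

/-- The automorphism `r x ↦ r (a x)`, `sr x ↦ sr (a x + d)` of the dihedral group. -/
def affineAut {n : ℕ} (a : (ZMod n)ˣ) (d : ZMod n) : MulAut (DihedralGroup n) where
  toFun
    | r x => r ((a : ZMod n) * x)
    | sr x => sr ((a : ZMod n) * x + d)
  invFun
    | r x => r ((a⁻¹ : (ZMod n)ˣ) * x)
    | sr x => sr ((a⁻¹ : (ZMod n)ˣ) * (x - d))
  left_inv := by rintro (x | x) <;> simp
  right_inv := by rintro (x | x) <;> simp
  map_mul' := by rintro (x | x) (y | y) <;> simp <;> ring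

@[simp] theorem affineAut_r {n : ℕ} (a : (ZMod n)ˣ) (d x : ZMod n) :
    affineAut a d (r x) = r ((a : ZMod n) * x) := rfl

@[simp] theorem affineAut_sr {n : ℕ} (a : (ZMod n)ˣ) (d x : ZMod n) :
    affineAut a d (sr x) = sr ((a : ZMod n) * x + d) := rfl

/-- A permutation conjugating right multiplication by the generating rotation to a permutation
commuting with it is affine on each coset of the rotation subgroup. -/
theorem exists_affine_of_commute [Fact p.Prime] (hodd : Odd p)
    (f : Equiv.Perm (DihedralGroup p)) (hf : f 1 = 1)
    (hcomm : Commute (Equiv.mulRight (r 1)) (f⁻¹ * Equiv.mulRight (r 1) * f)) :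
    ∃ a c d : ZMod p, a ≠ 0 ∧ c ≠ 0 ∧ (∀ x, f (r x) = r (a * x)) ∧
      ∀ x, f (sr x) = sr (c * x + d) := by
  set s : Equiv.Perm (DihedralGroup p) := f⁻¹ * Equiv.mulRight (r 1) * f with hs
  have hfs : ∀ x, f (s x) = f x * r 1 := fun x => by simp [hs]
  have hs1 : ∀ x, s (x * r 1) = s x * r 1 := fun x => (Equiv.congr_fun hcomm.eq x).symm
  have hsn : ∀ (n : ℕ) x, s (x * r n) = s x * r n := by
    intro n
    induction n with
    | zero => simp
    | succ n ih =>
      intro x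
      have : (r ((n + 1 : ℕ) : ZMod p)) = r (n : ZMod p) * r 1 := by simp
      rw [this, ← mul_assoc, hs1, ih, mul_assoc]
  have hsz : ∀ (z : ZMod p) x, s (x * r z) = s x * r z := fun z x => by
    simpa using hsn z.val x
  have hfn : ∀ (n : ℕ) x, f (s^[n] x) = f x * r n := by
    intro n
    induction n with
    | zero => simp
    | succ n ih =>
      intro x
      rw [Function.iterate_succ_apply', hfs, ih, mul_assoc, r_mul_r, Nat.cast_succ]
  have hsr1 : ∀ z, s (r z) = s 1 * r z := fun z => by simpa using hsz z 1
  have hsr2 : ∀ z, s (sr z) = s (sr 0) * r z := fun z => by simpa using hsz z (sr 0)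
  have hne : ∀ x, s x ≠ x := fun x hx => by
    have := hfs x
    rw [hx, left_eq_mul, one_def, r.injEq] at this
    exact one_ne_zero this
  -- Commuting with the translation, s either preserves both rotation cosets or moves one. If it
  -- preserves them, f carries the cycles of s to translation cycles, so its slopes are inverse to
  -- the steps of s.
  rcases h1 : s 1 with i | k
  · have hi : i ≠ 0 := by rintro rfl; exact hne 1 h1
    have hfr : ∀ x, f (r x) = r (i⁻¹ * x) := by
      intro x
      have hit : ∀ n : ℕ, s^[n] 1 = r ((n : ZMod p) * i) := by
        intro n
        induction n with
        | zero => simp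
        | succ n ih =>
          rw [Function.iterate_succ_apply', ih, hsr1, h1, r_mul_r, Nat.cast_succ]
          ring_nf
      have := hfn (i⁻¹ * x).val 1
      rw [hit, ZMod.natCast_zmod_val, hf, one_mul] at this
      rw [← this]
      congr 2
      field_simp
    rcases h2 : s (sr 0) with m | j
    · have : s (r (m - i)) = s (sr 0) := by rw [hsr1, h1, h2]; simp
      cases s.injective this
    have hj : j ≠ 0 := by rintro rfl; exact hne _ h2
    rcases h3 : f (sr 0) with m | d
    · have : f (r (i * m)) = f (sr 0) := by rw [hfr, h3]; congr 1; field_simp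
      cases f.injective this
    refine ⟨i⁻¹, j⁻¹, d, inv_ne_zero hi, inv_ne_zero hj, hfr, fun x => ?_⟩
    have hit : ∀ n : ℕ, s^[n] (sr 0) = sr ((n : ZMod p) * j) := by
      intro n
      induction n with
      | zero => simp
      | succ n ih =>
        rw [Function.iterate_succ_apply', ih, hsr2, h2, sr_mul_r, Nat.cast_succ]
        ring_nf
    have := hfn (j⁻¹ * x).val (sr 0)
    rw [hit, ZMod.natCast_zmod_val, h3, sr_mul_r, add_comm] at this
    rw [← this]
    congr 2
    field_simp
  -- If s swaps the cosets, so does s^p, as p is odd; but s is conjugate to a translation of order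
  -- p.
  · exfalso
    rcases h2 : s (sr 0) with m | m
    · obtain ⟨j, hj⟩ := hodd
      have hit : ∀ n : ℕ, ∃ z, s^[2 * n] 1 = r z := by
        intro n
        induction n with
        | zero => exact ⟨0, rfl⟩
        | succ n ih =>
          obtain ⟨z, hz⟩ := ih
          refine ⟨m + (k + z), ?_⟩
          rw [show 2 * (n + 1) = 2 * n + 1 + 1 by ring, Function.iterate_succ_apply',
            Function.iterate_succ_apply', hz, hsr1, h1, sr_mul_r, hsr2, h2, r_mul_r]
      obtain ⟨z, hz⟩ := hit j
      have hp := hfn p 1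
      have : s^[p] 1 = sr (k + z) := by
        have h : s^[p] 1 = s^[2 * j + 1] 1 := congrArg (fun n => s^[n] 1) hj
        rw [h, Function.iterate_succ_apply', hz, hsr1, h1, sr_mul_r]
      rw [this, CharP.cast_eq_zero, r_zero, mul_one] at hp
      cases f.injective hp
    · have : s (r (m - k)) = s (sr 0) := by rw [hsr1, h1, h2]; simp
      cases s.injective this

end DihedralGroup

/-! ### Babai's theorem. -/

/-- Right multiplication as an automorphism of a Cayley graph. -/
theorem cayleyGraph_adj_mul_right {G : Type*} [Group G] (S : ConnectionSet G) (g h k : G) :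
    (cayleyGraph S).Adj (g * k) (h * k) ↔ (cayleyGraph S).Adj g h := by
  simp [cayleyGraph, mul_assoc]

/-- The group of permutations of the vertices preserving the adjacency of a graph. -/
def SimpleGraph.autSubgroup {V : Type*} (X : SimpleGraph V) : Subgroup (Equiv.Perm V) where
  carrier := {e | ∀ x y, X.Adj (e x) (e y) ↔ X.Adj x y}
  mul_mem' ha hb x y := (ha _ _).trans (hb _ _)
  one_mem' _ _ := Iff.rfl
  inv_mem' {e} he x y := by simpa using (he (e⁻¹ x) (e⁻¹ y)).symm

/-- Isomorphic Cayley graphs on `D_{2p}` admit an isomorphism fixing the identity and conjugating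
right multiplication by the generating rotation to a permutation commuting with it. -/
theorem exists_iso_commute {p : ℕ} [Fact p.Prime] (hodd : Odd p)
    {S T : ConnectionSet (DihedralGroup p)} (e : cayleyGraph S ≃g cayleyGraph T) :
    ∃ f : Equiv.Perm (DihedralGroup p),
      (∀ x y, (cayleyGraph T).Adj (f x) (f y) ↔ (cayleyGraph S).Adj x y) ∧ f 1 = 1 ∧
      Commute (Equiv.mulRight (r 1)) (f⁻¹ * Equiv.mulRight (r 1) * f) := by
  set ρ : Equiv.Perm (DihedralGroup p) := Equiv.mulRight (r 1) with hρ
  set E : Equiv.Perm (DihedralGroup p) := e.toEquiv with hE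
  have hEadj : ∀ x y, (cayleyGraph T).Adj (E x) (E y) ↔ (cayleyGraph S).Adj x y :=
    fun x y => e.map_rel_iff
  have hρp : ρ ^ p = 1 := by
    rw [hρ, Equiv.pow_mulRight, r_one_pow_n]
    ext x
    simp
  have hρA : ∀ R : ConnectionSet (DihedralGroup p), ρ ∈ (cayleyGraph R).autSubgroup :=
    fun R x y => cayleyGraph_adj_mul_right R x y _
  let A := (cayleyGraph S).autSubgroup
  have hcA : ¬ p ^ 3 ∣ Nat.card A := fun h => by
    refine not_cube_dvd_factorial_two_mul Fact.out hodd (h.trans ?_)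
    simpa [Nat.card_perm, DihedralGroup.nat_card, -Nat.card_eq_fintype_card] using A.card_subgroup_dvd_card
  have hyA : E⁻¹ * ρ * E ∈ A := fun x y => by
    rw [← hEadj, ← hEadj x y]
    simpa using hρA T (E x) (E y)
  obtain ⟨g, hg⟩ := exists_commute_conj_of_not_dvd hcA (x := ⟨ρ, hρA S⟩) (y := ⟨_, hyA⟩)
    (Subtype.ext hρp) (Subtype.ext (by
      have : E⁻¹ * ρ * E = E⁻¹ * ρ * E⁻¹⁻¹ := by simp
      simp only [SubmonoidClass.mk_pow, this, conj_pow, hρp]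
      simp))
  have hg' : Commute ρ ((E * g.1⁻¹)⁻¹ * ρ * (E * g.1⁻¹)) := by
    have := congrArg Subtype.val hg.eq
    simp only [Subgroup.coe_mul, Subgroup.coe_inv] at this
    simpa [Commute, SemiconjBy, mul_assoc] using this
  set F : Equiv.Perm (DihedralGroup p) := E * g.1⁻¹ with hF
  -- A right translation restores f 1 = 1. It normalizes the powers of ρ, so commutation survives.
  refine ⟨Equiv.mulRight (F 1)⁻¹ * F, fun x y => ?_, by simp, ?_⟩
  · simp only [Equiv.Perm.mul_apply, Equiv.coe_mulRight, cayleyGraph_adj_mul_right]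
    rw [hF, Equiv.Perm.mul_apply, Equiv.Perm.mul_apply, hEadj]
    exact (g⁻¹).2 x y
  · have key : ∀ w : DihedralGroup p, ∃ k : ℤ,
        (Equiv.mulRight w)⁻¹ * ρ * Equiv.mulRight w = ρ ^ k := by
      rintro (w | w)
      · refine ⟨1, Equiv.ext fun x => ?_⟩
        simp [hρ, mul_assoc]
      · refine ⟨-1, Equiv.ext fun x => ?_⟩
        simp [hρ, mul_assoc]
    obtain ⟨k, hk⟩ := key (F 1)⁻¹
    have : (Equiv.mulRight (F 1)⁻¹ * F)⁻¹ * ρ * (Equiv.mulRight (F 1)⁻¹ * F) =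
        (F⁻¹ * ρ * F) ^ k := by
      have h2 : F⁻¹ * ρ * F = F⁻¹ * ρ * F⁻¹⁻¹ := by simp
      rw [h2, conj_zpow, ← hk]
      simp only [mul_assoc, mul_inv_rev, inv_inv]
    rw [this]
    exact hg'.zpow_right k

/-- **Babai's theorem** for graphs: isomorphic Cayley graphs on `D_{2p}` are related by a group
automorphism. -/
theorem exists_affineAut_of_iso {p : ℕ} [Fact p.Prime] (hodd : Odd p)
    {S T : ConnectionSet (DihedralGroup p)} (e : cayleyGraph S ≃g cayleyGraph T) :
    ∃ (a : (ZMod p)ˣ) (d : ZMod p), ∀ x, affineAut a d x ∈ T.1 ↔ x ∈ S.1 := by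
  obtain ⟨f, hadj, hf1, hcomm⟩ := exists_iso_commute hodd e
  obtain ⟨a, c, d, ha, hc, hr, hsr⟩ := exists_affine_of_commute hodd f hf1 hcomm
  have h1 : ∀ x y : ZMod p, sr (c * y + d - a * x) ∈ T.1 ↔ sr (y - x) ∈ S.1 := by
    intro x y
    simpa [cayleyGraph, hr, hsr, sub_eq_add_neg] using hadj (r x) (sr y)
  refine ⟨Units.mk0 a ha, d, ?_⟩
  rintro (x | x)
  · simpa [cayleyGraph, hr, hf1] using hadj 1 (r x)
  · change sr (a * x + d) ∈ T.1 ↔ _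
    by_cases hac : c = a
    · simpa [hac] using h1 0 x
    · have hac' : c - a ≠ 0 := sub_ne_zero.mpr hac
      -- The quotient is -x: the pair used is `r (-x)`, `sr 0`, for which the slope c drops out.
      have := h1 (((a - c) * x) / (c - a)) (x + ((a - c) * x) / (c - a))
      convert! this using 3
      · field_simp
        ring
      · ring

/-! ### Automorphisms acting on connection sets. -/

instance ConnectionSet.instFinite {G : Type*} [Group G] [Finite G] : Finite (ConnectionSet G) :=
  inferInstanceAs (Finite {S : Set G // (1 : G) ∉ S ∧ S⁻¹ = S})

/-- Group automorphisms act on connection sets by taking images. -/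
instance ConnectionSet.instMulAction {G : Type*} [Group G] :
    MulAction (MulAut G) (ConnectionSet G) where
  smul φ S := ⟨{x | φ⁻¹ x ∈ S.1}, by simpa using S.2.1, by
    ext x
    rw [Set.mem_inv, Set.mem_ofPred_eq, map_inv, ← Set.mem_inv, S.2.2, Set.mem_ofPred_eq]⟩
  one_smul S := rfl
  mul_smul φ ψ S := Subtype.ext <| Set.ext fun x => by
    change (φ * ψ)⁻¹ x ∈ S.1 ↔ ψ⁻¹ (φ⁻¹ x) ∈ S.1
    rw [mul_inv_rev, MulAut.mul_apply]

theorem ConnectionSet.mem_smul {G : Type*} [Group G] (φ : MulAut G) (S : ConnectionSet G) (x : G) :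
    x ∈ (φ • S).1 ↔ φ⁻¹ x ∈ S.1 := Iff.rfl

theorem ConnectionSet.smul_eq_iff {G : Type*} [Group G] (φ : MulAut G) (S T : ConnectionSet G) :
    φ • S = T ↔ ∀ x, φ x ∈ T.1 ↔ x ∈ S.1 := by
  constructor
  · rintro rfl x
    rw [mem_smul, MulAut.inv_apply_self]
  · intro h
    refine Subtype.ext (Set.ext fun x => ?_)
    rw [mem_smul, ← h, MulAut.apply_inv_self]

theorem cayleyGraph_injective {G : Type*} [Group G] :
    Function.Injective (cayleyGraph : ConnectionSet G → SimpleGraph G) := fun S T h =>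
  Subtype.ext <| Set.ext fun x => by
    have := congrArg (fun X : SimpleGraph G => X.Adj 1 x) h
    simpa [cayleyGraph] using this

/-- If isomorphic Cayley graphs on `G` are related by automorphisms of `G`, then counting Cayley
graphs up to isomorphism is counting orbits of the automorphism group. -/
theorem numCayleyGraphs_eq_card_orbits {G : Type*} [Group G]
    (hG : ∀ S T : ConnectionSet G, Nonempty (cayleyGraph S ≃g cayleyGraph T) →
      ∃ φ : MulAut G, φ • S = T) :
    numCayleyGraphs G = Nat.card (MulAction.orbitRel.Quotient (MulAut G) (ConnectionSet G)) := by
  let e : ConnectionSet G ≃ {X : SimpleGraph G // ∃ S : ConnectionSet G, X = cayleyGraph S} :=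
    Equiv.ofBijective (fun S => ⟨cayleyGraph S, S, rfl⟩)
      ⟨fun S T h => cayleyGraph_injective (congrArg Subtype.val h),
        fun ⟨X, S, h⟩ => ⟨S, Subtype.ext h.symm⟩⟩
  refine (Nat.card_congr (Quotient.congr e fun S T => ?_)).symm
  rw [MulAction.orbitRel_apply, MulAction.mem_orbit_iff]
  constructor
  · rintro ⟨φ, hφ⟩
    refine Setoid.symm' _ ⟨⟨φ.toEquiv, fun {x y} => ?_⟩⟩
    have := (ConnectionSet.smul_eq_iff φ T S).1 hφ (y * x⁻¹)
    rw [map_mul, map_inv] at this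
    exact this
  · intro h
    exact hG T S (Setoid.symm' (cayleyGraphIso G) h)

namespace DihedralGroup

variable {p : ℕ}

theorem affineAut_bijective [Fact p.Prime] (hodd : Odd p) :
    Function.Bijective
      (fun x : (ZMod p)ˣ × ZMod p => (affineAut x.1 x.2 : MulAut (DihedralGroup p))) := by
  constructor
  · rintro ⟨a, d⟩ ⟨b, c⟩ h
    have h1 := congrArg (fun φ : MulAut (DihedralGroup p) => φ (r 1)) h
    have h2 := congrArg (fun φ : MulAut (DihedralGroup p) => φ (sr 0)) h
    simp only [affineAut_r, affineAut_sr, r.injEq, sr.injEq, mul_one, mul_zero, zero_add] at h1 h2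
    exact Prod.ext (Units.ext h1) h2
  · intro φ
    rcases h1 : φ (r 1) with a | k
    · have hr : ∀ x, φ (r x) = r (a * x) := fun x => by
        have := congrArg φ (r_one_pow (n := p) x.val)
        rw [map_pow, h1, r_pow, ZMod.natCast_zmod_val] at this
        exact this.symm
      have ha : a ≠ 0 := by
        rintro rfl
        have := φ.injective (h1.trans (map_one φ).symm)
        rw [one_def, r.injEq] at this
        exact one_ne_zero this
      rcases h2 : φ (sr 0) with m | d
      · have : φ (r (a⁻¹ * m)) = φ (sr 0) := by rw [hr, h2, mul_inv_cancel_left₀ ha]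
        cases φ.injective this
      · refine ⟨(Units.mk0 a ha, d), MulEquiv.ext ?_⟩
        rintro (x | x)
        · exact (hr x).symm
        · have : φ (sr x) = φ (sr 0) * φ (r x) := by rw [← map_mul]; simp
          rw [this, h2, hr, sr_mul_r, add_comm]
          rfl
    · exfalso
      -- A reflection has order 2, whereas `r 1` has odd order p.
      have : orderOf (φ (r 1)) = orderOf (r 1 : DihedralGroup p) :=
        orderOf_injective φ.toMonoidHom φ.injective _
      rw [h1, orderOf_sr, orderOf_r_one] at this
      subst this
      exact absurd hodd (by decide)

/-- The connection sets fixed by an affine automorphism, split into rotations and reflections. -/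
def fixedByAffineAutEquiv [Fact p.Prime] (a : (ZMod p)ˣ) (d : ZMod p) :
    MulAction.fixedBy (ConnectionSet (DihedralGroup p)) (affineAut a d) ≃
      {A : Set (ZMod p)ˣ // (∀ x, a * x ∈ A ↔ x ∈ A) ∧ ∀ x, -x ∈ A ↔ x ∈ A} ×
      {B : Set (ZMod p) // ∀ x, a * x + d ∈ B ↔ x ∈ B} where
  -- Reflections are involutions, so inverse-closure constrains only the rotations; as 1 ∉ S, these
  -- are indexed by units.
  toFun S :=
    ⟨⟨{u | r (u : ZMod p) ∈ S.1.1},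
      fun u => (ConnectionSet.smul_eq_iff _ _ _).1 S.2 (r (u : ZMod p)), fun u => by
        change r (-u : ZMod p) ∈ S.1.1 ↔ r (u : ZMod p) ∈ S.1.1
        rw [← inv_r, ← Set.mem_inv, S.1.2.2]⟩,
     ⟨{x | sr x ∈ S.1.1}, fun x => (ConnectionSet.smul_eq_iff _ _ _).1 S.2 (sr x)⟩⟩
  invFun AB :=
    ⟨⟨{g | match g with
          | r x => ∃ u ∈ AB.1.1, (u : ZMod p) = x
          | sr x => x ∈ AB.2.1}, by
        rintro ⟨u, -, h⟩
        exact u.ne_zero h, by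
        ext x
        rcases x with x | x
        · simp only [Set.mem_inv, inv_r, Set.mem_ofPred_eq]
          constructor
          · rintro ⟨u, hu, h⟩
            exact ⟨-u, (AB.1.2.2 u).2 hu, by simp [h]⟩
          · rintro ⟨u, hu, h⟩
            exact ⟨-u, (AB.1.2.2 u).2 hu, by simp [h]⟩
        · simp⟩, by
      refine (ConnectionSet.smul_eq_iff _ _ _).2 ?_
      rintro (x | x)
      · simp only [affineAut_r, Set.mem_ofPred_eq]
        constructor
        · rintro ⟨u, hu, h⟩
          exact ⟨a⁻¹ * u, (AB.1.2.1 _).1 (by simpa using hu), by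
            rw [Units.val_mul, h, Units.inv_mul_cancel_left]⟩
        · rintro ⟨u, hu, h⟩
          exact ⟨a * u, (AB.1.2.1 u).2 hu, by simp [h]⟩
      · exact AB.2.2 x⟩
  left_inv S := by
    refine Subtype.ext (Subtype.ext (Set.ext ?_))
    rintro (x | x)
    · simp only [Set.mem_ofPred_eq]
      constructor
      · rintro ⟨u, hu, rfl⟩
        exact hu
      · intro hx
        have hx0 : x ≠ 0 := by
          rintro rfl
          exact S.1.2.1 hx
        exact ⟨Units.mk0 x hx0, hx, rfl⟩
    · rfl
  right_inv AB := by
    refine Prod.ext (Subtype.ext (Set.ext fun u => ?_)) rfl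
    constructor
    · rintro ⟨v, hv, h⟩
      rwa [← Units.ext h]
    · exact fun hu => ⟨u, hu, rfl⟩

end DihedralGroup

/-! ### Counting invariant sets. -/

/-- A finite group has `2 ^ [U : H]` subsets invariant under a given subgroup `H`. -/
theorem card_invariant_sets {U : Type*} [CommGroup U] [Finite U] (H : Subgroup U) :
    Nat.card {A : Set U // ∀ h ∈ H, ∀ x, h * x ∈ A ↔ x ∈ A} = 2 ^ H.index := by
  -- Invariant sets are the preimages of arbitrary subsets of the quotient.
  let e : Set (U ⧸ H) ≃ {A : Set U // ∀ h ∈ H, ∀ x, h * x ∈ A ↔ x ∈ A} :=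
    { toFun := fun Q => ⟨{x | (x : U ⧸ H) ∈ Q}, fun h hh x => by
        have : ((h * x : U) : U ⧸ H) = x := by
          rw [mul_comm]
          exact QuotientGroup.mk_mul_of_mem x hh
        rw [Set.mem_ofPred_eq, this, Set.mem_ofPred_eq]⟩
      invFun := fun A => QuotientGroup.mk '' A.1
      left_inv := fun Q => by
        ext q
        constructor
        · rintro ⟨x, hx, rfl⟩
          exact hx
        · intro hq
          obtain ⟨x, rfl⟩ := QuotientGroup.mk_surjective q
          exact ⟨x, hq, rfl⟩
      right_inv := fun A => by
        refine Subtype.ext (Set.ext fun x => ?_)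
        constructor
        · rintro ⟨y, hy, h⟩
          have := (A.2 _ (QuotientGroup.eq.1 h) y).2 hy
          rwa [mul_comm, mul_inv_cancel_left] at this
        · exact fun hx => ⟨x, hx, rfl⟩ }
  have := Fintype.ofFinite (U ⧸ H)
  rw [← Nat.card_congr e, Nat.card_eq_fintype_card, Fintype.card_set, Subgroup.index,
    Nat.card_eq_fintype_card]

theorem zpow_mul_mem_iff {U : Type*} [Group U] {A : Set U} {a : U}
    (h : ∀ x, a * x ∈ A ↔ x ∈ A) (k : ℤ) (x : U) : a ^ k * x ∈ A ↔ x ∈ A := by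
  induction k generalizing x with
  | zero => simp
  | succ n ih => rw [zpow_add_one, mul_assoc, ih, h]
  | pred n ih => rw [zpow_sub_one, mul_assoc, ih, ← h (a⁻¹ * x), mul_inv_cancel_left]

theorem card_invariant_sets_zpowers {U : Type*} [CommGroup U] [Finite U] (a : U) :
    Nat.card {A : Set U // ∀ x, a * x ∈ A ↔ x ∈ A} = 2 ^ (Subgroup.zpowers a).index := by
  rw [← card_invariant_sets]
  refine Nat.card_congr (Equiv.subtypeEquivRight fun A => ⟨?_, fun h => ?_⟩)
  · rintro h _ ⟨k, rfl⟩ x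
    exact zpow_mul_mem_iff h k x
  · exact h a (Subgroup.mem_zpowers a)

theorem sq_zpow {U : Type*} [Group U] (a : U) (k : ℤ) : (a ^ 2) ^ k = (a ^ k) ^ 2 := by
  rw [← zpow_natCast, zpow_comm, zpow_natCast]

section Units

variable {p : ℕ} [Fact p.Prime]

/-- The subgroup generated by a and -1 is the preimage of ⟨a²⟩ under squaring, since y² = (a^k)²
forces y = ±a^k. -/
theorem card_symmetric_invariant_sets (a : (ZMod p)ˣ) :
    Nat.card {A : Set (ZMod p)ˣ // (∀ x, a * x ∈ A ↔ x ∈ A) ∧ ∀ x, -x ∈ A ↔ x ∈ A} =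
      2 ^ ((Subgroup.zpowers (a ^ 2)).comap (powMonoidHom 2)).index := by
  rw [← card_invariant_sets]
  refine Nat.card_congr (Equiv.subtypeEquivRight fun A => ⟨?_, fun h => ⟨?_, fun x => ?_⟩⟩)
  · rintro ⟨h1, h2⟩ y ⟨k, hk⟩ x
    have hk' : y ^ 2 = (a ^ k) ^ 2 := by
      rw [← sq_zpow]
      exact hk.symm
    rcases Units.eq_or_eq_neg_of_sq_eq_sq _ _ hk' with rfl | rfl
    · exact zpow_mul_mem_iff h1 k x
    · rw [neg_mul, h2]
      exact zpow_mul_mem_iff h1 k x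
  · exact h a (Subgroup.mem_comap.2 (Subgroup.mem_zpowers _))
  · rw [← h (-1) (Subgroup.mem_comap.2 (by simp)) x, neg_one_mul]

theorem index_zpowers_pow {U : Type*} [Group U] [Finite U] {g : U}
    (hg : ∀ x, x ∈ Subgroup.zpowers g) (i : ℕ) :
    (Subgroup.zpowers (g ^ i)).index = Nat.gcd i (Nat.card U) := by
  have hord : orderOf g = Nat.card U := orderOf_eq_card_of_forall_mem_zpowers hg
  have h := (Subgroup.zpowers (g ^ i)).card_mul_index
  have hpos : 0 < Nat.card U := Nat.card_pos
  rw [Nat.card_zpowers, orderOf_pow, hord, Nat.gcd_comm] at h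
  have hd : Nat.gcd i (Nat.card U) ∣ Nat.card U := Nat.gcd_dvd_right _ _
  refine Nat.eq_of_mul_eq_mul_left (Nat.div_pos (Nat.le_of_dvd hpos hd)
    (Nat.gcd_pos_of_pos_right _ hpos)) (h.trans (Nat.div_mul_cancel hd).symm)

/-- The index of the preimage is that of ⟨g^(2i)⟩ inside the squares, which have index 2 in U. -/
theorem index_comap_sq {U : Type*} [CommGroup U] [Finite U] {g : U}
    (hg : ∀ x, x ∈ Subgroup.zpowers g) (heven : Even (Nat.card U)) (i : ℕ) :
    ((Subgroup.zpowers ((g ^ i) ^ 2)).comap (powMonoidHom 2)).index =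
      Nat.gcd (2 * i) (Nat.card U) / 2 := by
  have hrange : (powMonoidHom 2 : U →* U).range = Subgroup.zpowers (g ^ 2) := by
    ext x
    constructor
    · rintro ⟨y, rfl⟩
      obtain ⟨k, rfl⟩ := hg y
      exact ⟨k, sq_zpow g k⟩
    · rintro ⟨k, rfl⟩
      exact ⟨g ^ k, (sq_zpow g k).symm⟩
  have hle : Subgroup.zpowers ((g ^ i) ^ 2) ≤ (powMonoidHom 2 : U →* U).range := by
    rw [Subgroup.zpowers_le]
    exact ⟨g ^ i, rfl⟩
  have h := Subgroup.relIndex_mul_index hle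
  rw [hrange, index_zpowers_pow hg, Nat.gcd_eq_left heven.two_dvd, ← pow_mul,
    index_zpowers_pow hg] at h
  rw [Subgroup.index_comap, hrange, ← pow_mul, mul_comm 2 i, ← h]
  simp

theorem card_translation_invariant_sets {d : ZMod p} (hd : d ≠ 0) :
    Nat.card {B : Set (ZMod p) // ∀ x, x + d ∈ B ↔ x ∈ B} = 2 := by
  have key : ∀ B : Set (ZMod p), (∀ x, x + d ∈ B ↔ x ∈ B) → ∀ x, x ∈ B ↔ 0 ∈ B := by
    intro B hB x
    have hn : ∀ n : ℕ, (n : ZMod p) * d ∈ B ↔ 0 ∈ B := by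
      intro n
      induction n with
      | zero => simp
      | succ n ih => rw [Nat.cast_succ, add_mul, one_mul, hB, ih]
    simpa [hd] using hn (x * d⁻¹).val
  let e : {B : Set (ZMod p) // ∀ x, x + d ∈ B ↔ x ∈ B} ≃ Prop :=
    { toFun := fun B => 0 ∈ B.1
      invFun := fun P => ⟨{_x | P}, fun _ => Iff.rfl⟩
      left_inv := fun B => Subtype.ext (Set.ext fun x => (key B.1 B.2 x).symm)
      right_inv := fun P => rfl }
  rw [Nat.card_congr e, Nat.card_eq_fintype_card, Fintype.card_prop]

/-- For a ≠ 1 the map has the fixed point c = d/(1 - a). Recentring at c leaves multiplication by a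
on units, and membership of c is a free choice: hence the +1. -/
theorem card_affine_invariant_sets {a : (ZMod p)ˣ} (ha : a ≠ 1) (d : ZMod p) :
    Nat.card {B : Set (ZMod p) // ∀ x, a * x + d ∈ B ↔ x ∈ B} =
      2 ^ ((Subgroup.zpowers a).index + 1) := by
  have ha' : 1 - (a : ZMod p) ≠ 0 := sub_ne_zero.2 fun h => ha (Units.ext h.symm)
  set c : ZMod p := d / (1 - a) with hc
  have hcd : a * c + d = c := by
    rw [hc]
    field_simp
    ring
  let e : {B : Set (ZMod p) // ∀ x, a * x + d ∈ B ↔ x ∈ B} ≃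
      {A : Set (ZMod p)ˣ // ∀ x, a * x ∈ A ↔ x ∈ A} × Prop :=
    { toFun := fun B => ⟨⟨{u | (u : ZMod p) + c ∈ B.1}, fun u => by
        rw [Set.mem_ofPred_eq, Set.mem_ofPred_eq, ← B.2 (u + c)]
        have : (a : ZMod p) * (u + c) + d = (a * u : (ZMod p)ˣ) + c := by
          rw [mul_add, add_assoc, hcd, Units.val_mul]
        rw [this]⟩, c ∈ B.1⟩
      invFun := fun A => ⟨{x | (∃ u ∈ A.1.1, (u : ZMod p) + c = x) ∨ (x = c ∧ A.2)}, fun x => by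
        have h1 : (a : ZMod p) * x + d = c ↔ x = c := by
          nth_rewrite 1 [← hcd]
          simp
        simp only [Set.mem_ofPred_eq, h1]
        refine or_congr ⟨?_, ?_⟩ Iff.rfl
        · rintro ⟨u, hu, h⟩
          refine ⟨a⁻¹ * u, (A.1.2 _).1 (by simpa using hu), ?_⟩
          rw [← hcd, ← add_assoc, add_left_inj] at h
          have : (u : ZMod p) = a * (x - c) := by linear_combination h
          rw [Units.val_mul, this, Units.inv_mul_cancel_left, sub_add_cancel]
        · rintro ⟨u, hu, rfl⟩
          refine ⟨a * u, (A.1.2 u).2 hu, ?_⟩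
          rw [mul_add, add_assoc, hcd, Units.val_mul]⟩
      left_inv := fun B => by
        refine Subtype.ext (Set.ext fun x => ?_)
        constructor
        · rintro (⟨u, hu, rfl⟩ | ⟨rfl, h⟩)
          · exact hu
          · exact h
        · intro hx
          by_cases hxc : x = c
          · exact Or.inr ⟨hxc, hxc ▸ hx⟩
          · refine Or.inl ⟨Units.mk0 (x - c) (sub_ne_zero.2 hxc), ?_, by simp⟩
            simpa using hx
      right_inv := fun A => by
        refine Prod.ext (Subtype.ext (Set.ext fun u => ?_)) (propext ?_)
        · constructor
          · rintro (⟨v, hv, h⟩ | ⟨h, -⟩)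
            · rwa [← Units.ext (add_right_cancel h)]
            · exact absurd (add_eq_right.1 h) u.ne_zero
          · exact fun hu => Or.inl ⟨u, hu, rfl⟩
        · constructor
          · rintro (⟨v, -, h⟩ | ⟨-, h⟩)
            · exact absurd (add_eq_right.1 h) v.ne_zero
            · exact h
          · exact fun h => Or.inr ⟨rfl, h⟩ }
  rw [Nat.card_congr e, Nat.card_prod, card_invariant_sets_zpowers, Nat.card_eq_fintype_card,
    Fintype.card_prop, pow_succ]

end Units

/-! ### Burnside count. -/

theorem card_fixedBy_affineAut_of_ne_one {p : ℕ} [Fact p.Prime] (hodd : Odd p) {g : (ZMod p)ˣ}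
    (hg : ∀ x, x ∈ Subgroup.zpowers g) (i : ℕ) (hi : g ^ i ≠ 1) (d : ZMod p) :
    Nat.card (MulAction.fixedBy (ConnectionSet (DihedralGroup p)) (affineAut (g ^ i) d)) =
      2 * 2 ^ (Nat.gcd (2 * i) (p - 1) / 2 + Nat.gcd i (p - 1)) := by
  have hU : Nat.card (ZMod p)ˣ = p - 1 := by
    rw [Nat.card_eq_fintype_card, ZMod.card_units]
  have heven : Even (Nat.card (ZMod p)ˣ) := hU ▸ hodd.tsub_odd odd_one
  rw [Nat.card_congr (fixedByAffineAutEquiv _ d), Nat.card_prod, card_symmetric_invariant_sets,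
    index_comap_sq hg heven, card_affine_invariant_sets hi, index_zpowers_pow hg, hU]
  ring

theorem card_fixedBy_affineAut_one {p : ℕ} [Fact p.Prime] (hodd : Odd p) (d : ZMod p) :
    Nat.card (MulAction.fixedBy (ConnectionSet (DihedralGroup p)) (affineAut 1 d)) =
      2 ^ ((p - 1) / 2) * if d = 0 then 2 ^ p else 2 := by
  have hU : Nat.card (ZMod p)ˣ = p - 1 := by
    rw [Nat.card_eq_fintype_card, ZMod.card_units]
  have heven : Even (Nat.card (ZMod p)ˣ) := hU ▸ hodd.tsub_odd odd_one
  obtain ⟨g, hg⟩ := IsCyclic.exists_generator (α := (ZMod p)ˣ)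
  have h1 := index_comap_sq hg heven 0
  rw [pow_zero, mul_zero, Nat.gcd_zero_left, hU] at h1
  rw [Nat.card_congr (fixedByAffineAutEquiv _ d), Nat.card_prod, card_symmetric_invariant_sets, h1]
  simp only [Units.val_one, one_mul]
  congr 1
  split_ifs with hd
  · subst hd
    simp only [add_zero, implies_true]
    rw [Nat.card_congr (Equiv.subtypeUnivEquiv fun _ => trivial), Nat.card_eq_fintype_card,
      Fintype.card_set, ZMod.card]
  · exact card_translation_invariant_sets hd

/-- Burnside's lemma for the automorphism group of `D_{2p}` acting on connection sets. -/
theorem numCayleyGraphs_dihedral_mul {p : ℕ} [Fact p.Prime] (hodd : Odd p) :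
    numCayleyGraphs (DihedralGroup p) * ((p - 1) * p) =
      ∑ a : (ZMod p)ˣ, ∑ d : ZMod p,
        Nat.card (MulAction.fixedBy (ConnectionSet (DihedralGroup p)) (affineAut a d)) := by
  classical
  let e := Equiv.ofBijective _ (affineAut_bijective (p := p) hodd)
  have : Fintype (MulAut (DihedralGroup p)) := Fintype.ofEquiv _ e
  have : Fintype (ConnectionSet (DihedralGroup p)) := Fintype.ofFinite _
  have := Fintype.ofFinite
    (MulAction.orbitRel.Quotient (MulAut (DihedralGroup p)) (ConnectionSet (DihedralGroup p)))
  have hB := MulAction.sum_card_fixedBy_eq_card_orbits_mul_card_group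
    (MulAut (DihedralGroup p)) (ConnectionSet (DihedralGroup p))
  rw [numCayleyGraphs_eq_card_orbits, Nat.card_eq_fintype_card, ← Fintype.sum_prod_type']
  · have hcard : (p - 1) * p = Fintype.card (MulAut (DihedralGroup p)) := by
      rw [← Fintype.card_congr e, Fintype.card_prod, ZMod.card_units, ZMod.card]
    rw [hcard]
    refine hB.symm.trans ?_
    rw [← e.sum_comp]
    simp only [Nat.card_eq_fintype_card]
    rfl
  · rintro S T ⟨f⟩
    obtain ⟨a, d, h⟩ := exists_affineAut_of_iso hodd f
    exact ⟨affineAut a d, (ConnectionSet.smul_eq_iff _ _ _).2 h⟩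

theorem mainTheorem2 (p : ℕ) (hp : p.Prime) (hodd : Odd p) :
    (numCayleyGraphs (DihedralGroup p) : ℚ) =
      1 / (p : ℚ) * (2 ^ ((p + 1) / 2) - 2 ^ ((3 * p - 1) / 2)) +
        2 / ((p : ℚ) - 1) *
          ∑ i ∈ Finset.range (p - 1),
            2 ^ (Nat.gcd (2 * i) (p - 1) / 2 + Nat.gcd i (p - 1)) := by
  classical
  have : Fact p.Prime := ⟨hp⟩
  obtain ⟨g, hg⟩ := IsCyclic.exists_generator (α := (ZMod p)ˣ)
  have hU : Nat.card (ZMod p)ˣ = p - 1 := by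
    rw [Nat.card_eq_fintype_card, ZMod.card_units]
  have hord : orderOf g = p - 1 := (orderOf_eq_card_of_forall_mem_zpowers hg).trans hU
  have hB := numCayleyGraphs_dihedral_mul hodd
  have himg := IsCyclic.image_range_card hg
  rw [hU] at himg
  rw [← himg, Finset.sum_image (fun i hi j hj h => pow_injOn_Iio_orderOf
    (by simpa [hord] using hi) (by simpa [hord] using hj) h)] at hB
  obtain ⟨n, hn⟩ := hodd
  have hn0 : 0 < n := by have := hp.two_le; omega
  have hp1 : p - 1 = 2 * n := by omega
  have hsum : ∀ i ∈ Finset.range (2 * n - 1), ∑ d : ZMod p,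
      Nat.card (MulAction.fixedBy (ConnectionSet (DihedralGroup p)) (affineAut (g ^ (i + 1)) d)) =
      p * (2 * 2 ^ (Nat.gcd (2 * (i + 1)) (2 * n) / 2 + Nat.gcd (i + 1) (2 * n))) := by
    intro i hi
    have hi1 : g ^ (i + 1) ≠ 1 := by
      refine pow_ne_one_of_lt_orderOf (Nat.succ_ne_zero i) ?_
      have := Finset.mem_range.1 hi
      omega
    rw [← hp1, Finset.sum_congr rfl fun d _ =>
      card_fixedBy_affineAut_of_ne_one ⟨n, hn⟩ hg (i + 1) hi1 d]
    simp [ZMod.card]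
  have hsum0 : ∑ d : ZMod p,
      Nat.card (MulAction.fixedBy (ConnectionSet (DihedralGroup p)) (affineAut (g ^ 0) d)) =
      2 ^ n * (2 ^ (2 * n + 1) + 2 * n * 2) := by
    rw [pow_zero, Finset.sum_congr rfl fun d _ => card_fixedBy_affineAut_one ⟨n, hn⟩ d,
      ← Finset.mul_sum, ← Finset.add_sum_erase _ _ (Finset.mem_univ (0 : ZMod p)), if_pos rfl,
      Finset.sum_congr rfl fun d hd => if_neg (Finset.ne_of_mem_erase hd), Finset.sum_const,
      Finset.card_erase_of_mem (Finset.mem_univ _), Finset.card_univ, ZMod.card, hp1,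
      Nat.mul_div_cancel_left n two_pos, smul_eq_mul, hn]
  -- The index 0 is split off because a = 1 contributes 2^(3n+1) + n·2^(n+2) instead of the generic
  -- p·2^(3n+1), where p = 2n + 1.
  have hsplit : ∀ (M : Type) [AddCommMonoid M] (f : ℕ → M), ∑ i ∈ Finset.range (2 * n), f i =
      ∑ i ∈ Finset.range (2 * n - 1), f (i + 1) + f 0 := by
    intro M _ f
    rw [← Finset.sum_range_succ', show 2 * n - 1 + 1 = 2 * n by omega]
  rw [hp1, hsplit, Finset.sum_congr rfl hsum, hsum0, ← Finset.mul_sum, ← Finset.mul_sum] at hB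
  rw [hp1, hsplit, show (p + 1) / 2 = n + 1 by omega, show (3 * p - 1) / 2 = 3 * n + 1 by omega,
    mul_zero, Nat.gcd_zero_left, Nat.mul_div_cancel_left n two_pos]
  have hBQ := congrArg (Nat.cast : ℕ → ℚ) hB
  push_cast at hBQ
  have hpQ : (p : ℚ) = 2 * n + 1 := by rw [hn]; push_cast; ring
  have hnQ : (n : ℚ) ≠ 0 := by exact_mod_cast hn0.ne'
  have hpQ0 : (2 * n + 1 : ℚ) ≠ 0 := by positivity
  rw [hpQ] at hBQ ⊢
  rw [add_sub_cancel_right]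
  field_simp
  rw [show 3 * n + 1 = n + 2 * n + 1 by ring]
  generalize ∑ i ∈ Finset.range (2 * n - 1), (2 : ℚ) ^ _ = X at hBQ ⊢
  simp only [pow_succ, pow_add] at hBQ ⊢
  linear_combination hBQ / 2
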